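/- Let $\Lambda$ be an Artin algebra, let $n\ge 0$ be an integer, and suppose that $\Lambda$ is a minimal $n$-Auslander-Gorenstein algebra, that is, $\operatorname{id}{}_\Lambda\Lambda\le n+1\le\operatorname{domdim}\Lambda$, where $\operatorname{id}{}_\Lambda\Lambda$ is the injective dimension of $\Lambda$ as a left module over itself and $\operatorname{domdim}\Lambda$ is the supremum of all $m$ such that the first $m$ terms $I_0,\dots,I_{m-1}$ of a minimal injective coresolution $0\to\Lambda\to I_0\to I_1\to\cdots$ of the left module $\Lambda$ are projective. All modules are finitely generated left modules. A module is Gorenstein projective if it is isomorphic to the kernel of a differential of an exact complex, indexed by $\mathbb Z$, of finitely generated projective modules that remains exact under $\operatorname{Hom}_\Lambda(-,\Lambda)$. The Gorenstein projective dimension $\operatorname{Gpd}N$ of a module $N$ is the least $m\ge 0$ for which there is an exact sequence $0\to G_m\to\cdots\to G_0\to N\to 0$ with all $G_i$ Gorenstein projective ($\infty$ if there is none). The socle $\operatorname{soc}N$ is the sum of all simple submodules of $N$. Then an injective $\Lambda$-module $I$ is projective if and only if $\operatorname{Gpd}(\operatorname{soc}I)\le n$. That is, the full subcategory $\operatorname{prinj}(\Lambda)$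 of projective-injective $\Lambda$-modules satisfies $$\operatorname{prinj}(\Lambda)=\{I\in\Lambda\text{-}\mathrm{mod} : I \text{ is injective and } \operatorname{Gpd}(\operatorname{soc}I)\le n\}.$$ -/

import Mathlib

universe u v

/-- The socle of a module: the sum of all its simple submodules. -/
def socle (Λ : Type u) [Ring Λ] (M : Type u) [AddCommGroup M] [Module Λ M] : Submodule Λ M :=
  sSup {S : Submodule Λ M | IsSimpleModule Λ S}

/-- A submodule is essential if it meets every nonzero submodule nontrivially. -/
def IsEssentialSubmodule {Λ : Type u} [Ring Λ] {M : Type u} [AddCommGroup M] [Module Λ M]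
    (N : Submodule Λ M) : Prop :=
  ∀ K : Submodule Λ M, N ⊓ K = ⊥ → K = ⊥

/-- A minimal injective coresolution `0 → M → I⁰ → I¹ → I² → ⋯` of `M` by finitely generated
injective modules: the sequence is exact, `I⁰` is an essential extension of the image of `M`, and
each `Iʲ⁺¹` is an essential extension of the image of `Iʲ`. -/
structure MinimalInjectiveCoresolution (Λ : Type u) [Ring Λ]
    (M : Type u) [AddCommGroup M] [Module Λ M] where
  /-- the terms `Iʲ` -/
  term : ℕ → ModuleCat.{u} Λ
  /-- the augmentation `M → I⁰` -/
  aug : M →ₗ[Λ] term 0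
  /-- the differentials `Iʲ → Iʲ⁺¹` -/
  d : ∀ j, term j →ₗ[Λ] term (j + 1)
  finite : ∀ j, Module.Finite Λ (term j)
  injective : ∀ j, Module.Injective Λ (term j)
  aug_injective : Function.Injective aug
  exact_zero : Function.Exact aug (d 0)
  exact_succ : ∀ j, Function.Exact (d j) (d (j + 1))
  essential_zero : IsEssentialSubmodule (LinearMap.range aug)
  essential_succ : ∀ j, IsEssentialSubmodule (LinearMap.range (d j))

/-- The dominant dimension of `Λ` (as a left module over itself): the supremum of all `m` such that
the first `m` terms `I⁰, …, Iᵐ⁻¹` of a minimal injective coresolution of `Λ` are projective. -/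
noncomputable def dominantDimension (Λ : Type u) [Ring Λ] : ℕ∞ :=
  sSup {x : ℕ∞ | ∃ m : ℕ, x = m ∧ ∃ I : MinimalInjectiveCoresolution Λ Λ,
    ∀ j < m, Module.Projective Λ (I.term j)}

/-- The condition `id _ΛΛ ≤ n + 1 ≤ domdim Λ`, which defines the minimal `n`-Auslander-Gorenstein
algebras among the Artin algebras. -/
def IsMinimalAuslanderGorenstein (Λ : Type u) [Ring Λ] (n : ℕ) : Prop :=
  CategoryTheory.injectiveDimension (ModuleCat.of Λ Λ) ≤ ((n + 1 : ℕ) : WithBot ℕ∞) ∧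
    ((n + 1 : ℕ) : ℕ∞) ≤ dominantDimension Λ

/-- A totally acyclic complex `⋯ → Pⁱ → Pⁱ⁺¹ → ⋯` (`i ∈ ℤ`): an exact complex of finitely generated
projective modules that stays exact under `Hom_Λ(-, Λ)`. -/
structure TotallyAcyclicComplex (Λ : Type u) [Ring Λ] where
  /-- the terms `Pⁱ` -/
  term : ℤ → ModuleCat.{u} Λ
  /-- the differentials `Pⁱ → Pⁱ⁺¹` -/
  d : ∀ i, term i →ₗ[Λ] term (i + 1)
  finite : ∀ i, Module.Finite Λ (term i)
  projective : ∀ i, Module.Projective Λ (term i)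
  exact : ∀ i, Function.Exact (d i) (d (i + 1))
  hom_exact : ∀ (i : ℤ) (f : term (i + 1) →ₗ[Λ] Λ), f ∘ₗ d i = 0 →
    ∃ g : term (i + 1 + 1) →ₗ[Λ] Λ, g ∘ₗ d (i + 1) = f

/-- A (finitely generated) module is Gorenstein projective if it is isomorphic to the module of
degree-zero cocycles of a totally acyclic complex. -/
def IsGorensteinProjective (Λ : Type u) [Ring Λ]
    (M : Type u) [AddCommGroup M] [Module Λ M] : Prop :=
  ∃ P : TotallyAcyclicComplex Λ, Nonempty (M ≃ₗ[Λ] LinearMap.ker (P.d 0))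

/-- `M` has a Gorenstein projective resolution `0 → Gₙ → ⋯ → G₁ → G₀ → M → 0` of length `n`
(built by splicing short exact sequences `0 → K → G₀ → M → 0`). -/
def HasGorensteinProjectiveResolution (Λ : Type u) [Ring Λ] :
    (n : ℕ) → (M : Type u) → [AddCommGroup M] → [Module Λ M] → Prop
  | 0, M, _, _ => IsGorensteinProjective Λ M
  | n + 1, M, _, _ => ∃ (K G : ModuleCat.{u} Λ) (i : K →ₗ[Λ] G) (p : G →ₗ[Λ] M),
      Function.Injective i ∧ Function.Exact i p ∧ Function.Surjective p ∧
        IsGorensteinProjective Λ G ∧ HasGorensteinProjectiveResolution Λ n K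

/-- The Gorenstein projective dimension: the least length of a Gorenstein projective resolution,
and `⊤` if there is none. -/
noncomputable def Gpd (Λ : Type u) [Ring Λ] (M : Type u) [AddCommGroup M] [Module Λ M] : ℕ∞ :=
  sInf {x : ℕ∞ | ∃ n : ℕ, x = n ∧ HasGorensteinProjectiveResolution Λ n M}

/-- The full subcategory of finitely generated modules that are both projective and injective. -/
def prinj (Λ : Type u) [Ring Λ] : CategoryTheory.ObjectProperty (ModuleCat.{u} Λ) :=
  fun I => Module.Finite Λ I ∧ Module.Projective Λ I ∧ Module.Injective Λ I

/-! A finitely generated module has Gorenstein projective dimension at most `n` if and only if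
`Extⁱ(-, Λ)` vanishes on it for `i > n`. This holds for submodules of projective modules, since
`id Λ ≤ n + 1`. In the other direction, an injective module is projective as soon as its socle
embeds in a projective-injective module, so the point is that a finitely generated `D` with
`Extⁿ⁺¹(D, Λ) = 0` has such an embedding. For `D` orthogonal to `Λ` this embedding also starts the
right half of a totally acyclic complex, which gives the criterion for the dimension.

Let `C` be the injective `(n + 1)`-st cosyzygy of `Λ`. Dimension shift along the
projective-injective terms identifies `Extⁿ⁺¹(-, Λ)` with `Hom(-, C)` modulo maps that factor
through the last of these terms. An indecomposable summand `P` of `Λ` has a simple top and a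
simple partner at its other end: a submodule of `P` if `P` is injective, and otherwise a simple
`T` with `Extⁿ⁺¹(T, P) ≠ 0`. The partner determines `P`, hence the top. As there are only finitely
many simple modules, every simple module is a partner, so it embeds in a projective-injective
module or has `Extⁿ⁺¹(-, Λ) ≠ 0`; since `C` is injective, the simple submodules of `D` are of the
first kind. -/

open CategoryTheory CategoryTheory.Abelian

universe v' u' w

section Ext

variable {𝒞 : Type u'} [Category.{v'} 𝒞] [Abelian 𝒞] [HasExt.{w} 𝒞] {Y : 𝒞}

theorem subsingleton_ext_of_retract {X X' : 𝒞} (r : Retract X X') {i : ℕ}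
    [Subsingleton (Ext X' Y i)] : Subsingleton (Ext X Y i) := by
  refine Function.Injective.subsingleton
    (f := fun z : Ext X Y i => (Ext.mk₀ r.r).comp z (zero_add i)) fun z z' h => ?_
  simpa using congr((Ext.mk₀ r.i).comp $h (zero_add i))

variable {S : ShortComplex 𝒞}

theorem subsingleton_ext_X₁ (hS : S.ShortExact) {i : ℕ} [Subsingleton (Ext S.X₂ Y i)]
    [Subsingleton (Ext S.X₃ Y (i + 1))] : Subsingleton (Ext S.X₁ Y i) := by
  refine subsingleton_of_forall_eq 0 fun z => ?_
  obtain ⟨y, rfl⟩ := Ext.contravariant_sequence_exact₁ hS Y z (add_comm 1 i)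
    (Subsingleton.elim _ _)
  rw [Subsingleton.elim y 0, Ext.comp_zero]

theorem subsingleton_ext_X₂ (hS : S.ShortExact) {i : ℕ} [Subsingleton (Ext S.X₁ Y i)]
    [Subsingleton (Ext S.X₃ Y i)] : Subsingleton (Ext S.X₂ Y i) := by
  refine subsingleton_of_forall_eq 0 fun z => ?_
  obtain ⟨y, rfl⟩ := Ext.contravariant_sequence_exact₂ hS Y z (Subsingleton.elim _ _)
  rw [Subsingleton.elim y 0, Ext.comp_zero]

theorem subsingleton_ext_X₃ (hS : S.ShortExact) {i : ℕ} [Subsingleton (Ext S.X₁ Y i)]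
    [Subsingleton (Ext S.X₂ Y (i + 1))] : Subsingleton (Ext S.X₃ Y (i + 1)) := by
  refine subsingleton_of_forall_eq 0 fun z => ?_
  obtain ⟨y, rfl⟩ := Ext.contravariant_sequence_exact₃ hS Y z (Subsingleton.elim _ _)
    (add_comm 1 i)
  rw [Subsingleton.elim y 0, Ext.comp_zero]

theorem subsingleton_ext_one_iff (hS : S.ShortExact) [Projective S.X₂] :
    Subsingleton (Ext S.X₃ Y 1) ↔ ∀ f : S.X₁ ⟶ Y, ∃ g : S.X₂ ⟶ Y, S.f ≫ g = f := by
  refine ⟨fun _ f => ?_, fun h => subsingleton_of_forall_eq 0 fun z => ?_⟩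
  · obtain ⟨g, hg⟩ := Ext.contravariant_sequence_exact₁ hS Y (Ext.mk₀ f) (add_zero 1)
      (Subsingleton.elim _ _)
    obtain ⟨g, rfl⟩ := (Ext.mk₀_bijective _ _).2 g
    exact ⟨g, (Ext.mk₀_bijective _ _).1 (by rw [← hg, Ext.mk₀_comp_mk₀])⟩
  · obtain ⟨f, rfl⟩ := Ext.contravariant_sequence_exact₃ hS Y z
      (Ext.eq_zero_of_projective _) (add_zero 1)
    obtain ⟨f, rfl⟩ := (Ext.mk₀_bijective _ _).2 f
    obtain ⟨g, rfl⟩ := h f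
    rw [← Ext.mk₀_comp_mk₀, ← Ext.comp_assoc (h₁₂ := add_zero 1) (h := by omega),
      hS.extClass_comp, Ext.zero_comp]

theorem subsingleton_ext_of_mono_of_projective {M P : 𝒞} (i : M ⟶ P) [Mono i] [Projective P]
    {n : ℕ} [HasInjectiveDimensionLT Y (n + 2)] {k : ℕ} (hk : n + 1 ≤ k) :
    Subsingleton (Ext M Y k) := by
  have hS : (ShortComplex.mk i (Limits.cokernel.π i) (by simp)).ShortExact :=
    { exact := ShortComplex.exact_cokernel i }
  have : Subsingleton (Ext (Limits.cokernel i) Y (k + 1)) :=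
    HasInjectiveDimensionLT.subsingleton Y (n + 2) _ (by omega) _
  obtain ⟨k, rfl⟩ : ∃ j, k = j + 1 := ⟨k - 1, by omega⟩
  have := Ext.subsingleton_of_projective P Y k
  exact subsingleton_ext_X₁ hS

end Ext

section CosyzygyClass

variable {𝒞 : Type u'} [Category.{v'} 𝒞] [Abelian 𝒞] [HasExt.{w} 𝒞]
  {J : ObjectProperty 𝒞} {X C : 𝒞} {k : ℕ}

/-- `IsCosyzygyClass J X ξ` says that `ξ ∈ Ext C X k` is the Yoneda class of an exact sequence
`0 → X → Q₁ → ⋯ → Qₖ → C → 0` in which every `Qᵢ` satisfies `J`. It records both the fact that `C`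
is a `k`-th cosyzygy of `X` relative to `J` and the dimension shift this gives. -/
inductive IsCosyzygyClass (J : ObjectProperty 𝒞) (X : 𝒞) : ∀ {k : ℕ} {C : 𝒞}, Ext C X k → Prop
  | zero : IsCosyzygyClass J X (Ext.mk₀ (𝟙 X))
  | succ {k : ℕ} {S : ShortComplex 𝒞} (hS : S.ShortExact) (hJ : J S.X₂) {ξ : Ext S.X₁ X k}
      (hξ : IsCosyzygyClass J X ξ) : IsCosyzygyClass J X (hS.extClass.comp ξ (add_comm 1 k))

namespace IsCosyzygyClass

variable {ξ : Ext C X k}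

theorem exists_comp_eq (hξ : IsCosyzygyClass J X ξ) (hJ : J ≤ isInjective 𝒞) {D : 𝒞} {i m : ℕ}
    (hm : i + k = m) (z : Ext D X m) : ∃ x : Ext D C i, x.comp ξ hm = z := by
  induction hξ generalizing i with
  | zero =>
    obtain rfl : i = m := hm
    exact ⟨z, Ext.comp_mk₀_id z⟩
  | @succ k S hS hS₂ ξ _ ih =>
    have : Injective S.X₂ := hJ _ hS₂
    obtain ⟨y, rfl⟩ := ih (i := i + 1) (by omega)
    obtain ⟨x, rfl⟩ := Ext.covariant_sequence_exact₁ D hS y (Ext.eq_zero_of_injective _) rfl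
    exact ⟨x, by rw [Ext.comp_assoc]; omega⟩

theorem exists_eq_comp (hξ : IsCosyzygyClass J X ξ) (hJ : J ≤ isProjective 𝒞) {Y : 𝒞} {i m : ℕ}
    (hm : k + i = m) (z : Ext C Y m) : ∃ x : Ext X Y i, z = ξ.comp x hm := by
  induction hξ generalizing m with
  | zero =>
    obtain rfl : i = m := by omega
    exact ⟨z, (Ext.mk₀_id_comp z).symm⟩
  | @succ k S hS hS₂ ξ _ ih =>
    have : Projective S.X₂ := hJ _ hS₂
    obtain ⟨m, rfl⟩ : ∃ j, m = j + 1 := ⟨k + i, by omega⟩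
    obtain ⟨y, rfl⟩ := Ext.contravariant_sequence_exact₃ hS Y z (Ext.eq_zero_of_projective _)
      (add_comm 1 m)
    obtain ⟨x, rfl⟩ := ih (by omega) y
    exact ⟨x, by rw [Ext.comp_assoc]; omega⟩

theorem hasInjectiveDimensionLT (hξ : IsCosyzygyClass J X ξ) (hJ : J ≤ isInjective 𝒞) {m : ℕ}
    [hX : HasInjectiveDimensionLT X (k + m + 1)] : HasInjectiveDimensionLT C (m + 1) := by
  induction hξ generalizing m with
  | zero => rwa [zero_add] at hX
  | @succ k S hS hS₂ _ _ ih =>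
    rw [hS.hasInjectiveDimensionLT_X₃_iff m (hJ _ hS₂)]
    exact ih (m := m + 1) (hX := by rwa [add_right_comm k 1 m] at hX)

theorem exists_factorization_of_comp_mk₀_eq_comp (hξ : IsCosyzygyClass J X ξ)
    (hJ : J ≤ isProjective 𝒞) {Q Y : 𝒞} (hQ : J Q) (f : X ⟶ Y) (a : C ⟶ Q) (y : Ext Q Y k)
    (h : ξ.comp (Ext.mk₀ f) (add_zero k) = (Ext.mk₀ a).comp y (zero_add k)) :
    ∃ Q, J Q ∧ ∃ (b : X ⟶ Q) (c : Q ⟶ Y), b ≫ c = f := by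
  induction hξ generalizing Q with
  | zero =>
    obtain ⟨y, rfl⟩ := (Ext.mk₀_bijective _ _).2 y
    rw [Ext.mk₀_id_comp, Ext.mk₀_comp_mk₀] at h
    exact ⟨Q, hQ, a, y, ((Ext.mk₀_bijective _ _).1 h).symm⟩
  | @succ k S hS hS₂ ξ _ ih =>
    have : Projective Q := hJ _ hQ
    rw [Ext.eq_zero_of_projective y, Ext.comp_zero, Ext.comp_assoc_of_third_deg_zero] at h
    obtain ⟨z, hz⟩ := Ext.contravariant_sequence_exact₁ hS Y _ _ h
    exact ih hS₂ S.f z hz.symm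

theorem exists_factorization_of_comp_mk₀_eq_zero {ξ : Ext C X (k + 1)}
    (hξ : IsCosyzygyClass J X ξ) (hJ : J ≤ isProjective 𝒞) {Y : 𝒞} (f : X ⟶ Y)
    (h : ξ.comp (Ext.mk₀ f) (add_zero (k + 1)) = 0) :
    ∃ Q, J Q ∧ ∃ (b : X ⟶ Q) (c : Q ⟶ Y), b ≫ c = f := by
  cases hξ with
  | @succ _ S hS hS₂ ξ hξ =>
    rw [Ext.comp_assoc_of_third_deg_zero] at h
    obtain ⟨z, hz⟩ := Ext.contravariant_sequence_exact₁ hS Y _ _ h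
    exact hξ.exists_factorization_of_comp_mk₀_eq_comp hJ hS₂ f S.f z hz.symm

theorem exists_comp_mk₀_eq_of_simple (hJi : J ≤ isInjective 𝒞) (hJp : J ≤ isProjective 𝒞)
    {X₁ X₂ C₁ C₂ T : 𝒞} [Simple T] [Injective C₂] {ξ₁ : Ext C₁ X₁ k} {ξ₂ : Ext C₂ X₂ k}
    (hξ₁ : IsCosyzygyClass J X₁ ξ₁) (hξ₂ : IsCosyzygyClass J X₂ ξ₂)
    {x₁ : Ext T X₁ k} (hx₁ : x₁ ≠ 0) (x₂ : Ext T X₂ k) :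
    ∃ f : X₁ ⟶ X₂, x₁.comp (Ext.mk₀ f) (add_zero k) = x₂ := by
  obtain ⟨i₁, rfl⟩ := hξ₁.exists_comp_eq hJi (zero_add k) x₁
  obtain ⟨i₂, rfl⟩ := hξ₂.exists_comp_eq hJi (zero_add k) x₂
  obtain ⟨i₁, rfl⟩ := (Ext.mk₀_bijective _ _).2 i₁
  obtain ⟨i₂, rfl⟩ := (Ext.mk₀_bijective _ _).2 i₂
  have : Mono i₁ := mono_of_nonzero_from_simple fun h => hx₁ (by simp [h])
  obtain ⟨f, hf⟩ := hξ₁.exists_eq_comp hJp (add_zero k)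
    ((Ext.mk₀ (Injective.factorThru i₂ i₁)).comp ξ₂ (zero_add k))
  obtain ⟨f, rfl⟩ := (Ext.mk₀_bijective _ _).2 f
  refine ⟨f, ?_⟩
  rw [Ext.comp_assoc_of_third_deg_zero, ← hf, Ext.mk₀_comp_mk₀_assoc, Injective.comp_factorThru]

end IsCosyzygyClass

end CosyzygyClass

section LocalEndomorphismRing

variable {𝒞 : Type u'} [Category.{v'} 𝒞] [Abelian 𝒞]

theorem isIso_or_isIso_id_sub {P : 𝒞} [IsLocalRing (End P)] (f : P ⟶ P) :
    IsIso f ∨ IsIso (𝟙 P - f) := by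
  rw [← isUnit_iff_isIso, ← isUnit_iff_isIso]
  exact IsLocalRing.isUnit_or_isUnit_of_add_one (add_sub_cancel (G := End P) f 1)

theorem isIso_of_comp_mk₀_eq_self [HasExt.{w} 𝒞] {T P : 𝒞} [IsLocalRing (End P)] {k : ℕ}
    {x : Ext T P k} (hx : x ≠ 0) {f : P ⟶ P} (h : x.comp (Ext.mk₀ f) (add_zero k) = x) :
    IsIso f := by
  refine (isIso_or_isIso_id_sub f).resolve_right fun _ => hx ?_
  have h₀ : x.comp (Ext.mk₀ (𝟙 P - f)) (add_zero k) = 0 := by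
    rw [sub_eq_add_neg, Ext.mk₀_add, Ext.mk₀_neg, Ext.comp_add, Ext.comp_neg, Ext.comp_mk₀_id, h,
      add_neg_cancel]
  simpa using congr(($h₀).comp (Ext.mk₀ (inv (𝟙 P - f))) (add_zero k))

theorem nonempty_iso_of_simple_of_projective {P S₁ S₂ : 𝒞} [Projective P] [IsLocalRing (End P)]
    [Simple S₁] [Simple S₂] {p₁ : P ⟶ S₁} {p₂ : P ⟶ S₂} (h₁ : p₁ ≠ 0) (h₂ : p₂ ≠ 0) :
    Nonempty (S₁ ≅ S₂) := by
  have : Epi p₁ := epi_of_nonzero_to_simple h₁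
  by_cases h : Limits.kernel.ι p₁ ≫ p₂ = 0
  · have : IsIso (Abelian.epiDesc p₁ p₂ h) :=
      isIso_of_hom_simple fun h₀ =>
        h₂ (by rw [← Abelian.comp_epiDesc p₁ p₂ h, h₀, Limits.comp_zero])
    exact ⟨asIso (Abelian.epiDesc p₁ p₂ h)⟩
  · have : Epi (Limits.kernel.ι p₁ ≫ p₂) := epi_of_nonzero_to_simple h
    let f : P ⟶ P := Projective.factorThru p₂ (Limits.kernel.ι p₁ ≫ p₂) ≫ Limits.kernel.ι p₁
    have hf₁ : f ≫ p₁ = 0 := by simp [f]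
    have hf₂ : f ≫ p₂ = p₂ := by simp [f]
    obtain _ | _ := isIso_or_isIso_id_sub f
    · exact (h₁ ((cancel_epi f).1 (by rw [hf₁, Limits.comp_zero]))).elim
    · refine (h₂ ((cancel_epi (𝟙 P - f)).1 ?_)).elim
      rw [Preadditive.sub_comp, Category.id_comp, hf₂, sub_self, Limits.comp_zero]

theorem exists_comp_mk₀_eq_of_retract [HasExt.{w} 𝒞] {J : ObjectProperty 𝒞}
    (hJi : J ≤ isInjective 𝒞) (hJp : J ≤ isProjective 𝒞) {X₁ X₂ C₁ C₂ P₁ P₂ T : 𝒞} [Simple T]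
    [Injective C₂] {k : ℕ} {ξ₁ : Ext C₁ X₁ k} {ξ₂ : Ext C₂ X₂ k} (hξ₁ : IsCosyzygyClass J X₁ ξ₁)
    (hξ₂ : IsCosyzygyClass J X₂ ξ₂) (r₁ : Retract P₁ X₁) (r₂ : Retract P₂ X₂) {x₁ : Ext T P₁ k}
    (hx₁ : x₁ ≠ 0) (x₂ : Ext T P₂ k) :
    ∃ f : P₁ ⟶ P₂, x₁.comp (Ext.mk₀ f) (add_zero k) = x₂ := by
  have h₁ : x₁.comp (Ext.mk₀ r₁.i) (add_zero k) ≠ 0 := fun h =>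
    hx₁ (by simpa using congr(($h).comp (Ext.mk₀ r₁.r) (add_zero k)))
  obtain ⟨f, hf⟩ := hξ₁.exists_comp_mk₀_eq_of_simple hJi hJp hξ₂ h₁
    (x₂.comp (Ext.mk₀ r₂.i) (add_zero k))
  exact ⟨r₁.i ≫ f ≫ r₂.r, by simpa using congr(($hf).comp (Ext.mk₀ r₂.r) (add_zero k))⟩

theorem nonempty_iso_of_ext_ne_zero [HasExt.{w} 𝒞] {J : ObjectProperty 𝒞}
    (hJi : J ≤ isInjective 𝒞) (hJp : J ≤ isProjective 𝒞) {X₁ X₂ C₁ C₂ P₁ P₂ S₁ S₂ T : 𝒞}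
    [Injective C₁] [Injective C₂] [Projective P₁] [IsLocalRing (End P₁)] [IsLocalRing (End P₂)]
    [Simple S₁] [Simple S₂] [Simple T] {k : ℕ} {ξ₁ : Ext C₁ X₁ k} {ξ₂ : Ext C₂ X₂ k}
    (hξ₁ : IsCosyzygyClass J X₁ ξ₁) (hξ₂ : IsCosyzygyClass J X₂ ξ₂) (r₁ : Retract P₁ X₁)
    (r₂ : Retract P₂ X₂) {x₁ : Ext T P₁ k} (hx₁ : x₁ ≠ 0) {x₂ : Ext T P₂ k} (hx₂ : x₂ ≠ 0)
    {p₁ : P₁ ⟶ S₁} (hp₁ : p₁ ≠ 0) {p₂ : P₂ ⟶ S₂} (hp₂ : p₂ ≠ 0) : Nonempty (S₁ ≅ S₂) := by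
  obtain ⟨f, hf⟩ := exists_comp_mk₀_eq_of_retract hJi hJp hξ₁ hξ₂ r₁ r₂ hx₁ x₂
  obtain ⟨g, hg⟩ := exists_comp_mk₀_eq_of_retract hJi hJp hξ₂ hξ₁ r₂ r₁ hx₂ x₁
  have : IsIso (g ≫ f) := isIso_of_comp_mk₀_eq_self hx₂ <| by
    rw [← Ext.mk₀_comp_mk₀, ← Ext.comp_assoc_of_third_deg_zero, hg, hf]
  refine nonempty_iso_of_simple_of_projective hp₁ (p₂ := f ≫ p₂) fun h => hp₂ ?_
  rw [← cancel_epi (g ≫ f), Category.assoc, h, Limits.comp_zero, Limits.comp_zero]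

end LocalEndomorphismRing

section FiniteLength

variable {Λ : Type u} [Ring Λ] {M : Type*} [AddCommGroup M] [Module Λ M]

theorem isCompl_map_subtype {K K' : Submodule Λ M} (hK : IsCompl K K') {A B : Submodule Λ K}
    (hAB : IsCompl A B) : IsCompl (A.map K.subtype) (B.map K.subtype ⊔ K') := by
  have hsup : A.map K.subtype ⊔ B.map K.subtype = K := by
    rw [← Submodule.map_sup, hAB.sup_eq_top, Submodule.map_subtype_top]
  have hdisj : Disjoint (A.map K.subtype) (B.map K.subtype) :=
    (Submodule.disjoint_map K.injective_subtype hAB.disjoint)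
  refine ⟨hdisj.disjoint_sup_right_of_disjoint_sup_left (by rw [hsup]; exact hK.disjoint), ?_⟩
  rw [codisjoint_iff, ← sup_assoc, hsup, hK.sup_eq_top]

theorem exists_isCompl_isLocalRing_end [IsArtinian Λ M] [IsNoetherian Λ M] {N : Submodule Λ M}
    (hN : N ≠ ⊤) :
    ∃ K K' : Submodule Λ M, IsCompl K K' ∧ ¬ K ≤ N ∧ IsLocalRing (Module.End Λ K) := by
  obtain ⟨K, ⟨⟨K', hK⟩, hKN⟩, hmin⟩ := IsArtinian.set_has_minimal
    {K : Submodule Λ M | (∃ K', IsCompl K K') ∧ ¬ K ≤ N} ⟨⊤, ⟨⊥, isCompl_top_bot⟩, by simpa⟩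
  refine ⟨K, K', hK, hKN, ?_⟩
  have eq_top {A B : Submodule Λ K} (h : IsCompl A B) (hA : ¬ A.map K.subtype ≤ N) : A = ⊤ := by
    have hlt := hmin _ ⟨⟨_, isCompl_map_subtype hK h⟩, hA⟩
    have := (Submodule.map_subtype_le K A).eq_of_not_lt hlt
    exact Submodule.map_injective_of_injective K.injective_subtype
      (this.trans (Submodule.map_subtype_top K).symm)
  have : Nontrivial K := Submodule.nontrivial_iff_ne_bot.2 (by rintro rfl; exact hKN bot_le)
  refine .of_isUnit_or_isUnit_one_sub_self fun f => ?_
  obtain ⟨n, hn, hn₀⟩ :=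
    (f.eventually_isCompl_ker_pow_range_pow.and (Filter.eventually_ne_atTop 0)).exists
  by_cases hker : (LinearMap.ker (f ^ n)).map K.subtype ≤ N
  · have hrange : LinearMap.range (f ^ n) = ⊤ := eq_top hn.symm fun hr => hKN <| by
      rw [← Submodule.map_subtype_top K, ← hn.sup_eq_top, Submodule.map_sup]
      exact sup_le hker hr
    left
    rw [← isUnit_pow_iff hn₀, Module.End.isUnit_iff]
    have hker : LinearMap.ker (f ^ n) = ⊥ := by simpa [hrange] using hn.disjoint
    exact ⟨LinearMap.ker_eq_bot.1 hker, LinearMap.range_eq_top.1 hrange⟩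
  · exact .inr (IsNilpotent.isUnit_one_sub ⟨n, LinearMap.ker_eq_top.1 (eq_top hn hker)⟩)

theorem exists_linearEquiv_submodule_quotient_jacobson [IsArtinianRing Λ] (T : Type*)
    [AddCommGroup T] [Module Λ T] [IsSimpleModule Λ T] :
    ∃ N : Submodule Λ (Λ ⧸ Ring.jacobson Λ), Nonempty (T ≃ₗ[Λ] N) := by
  obtain ⟨m, hm, ⟨e⟩⟩ := isSimpleModule_iff_quot_maximal.1 ‹IsSimpleModule Λ T›
  have : IsSemisimpleModule Λ (Λ ⧸ Ring.jacobson Λ) :=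
    (IsArtinian.isSemisimpleModule_iff_jacobson Λ _).2 (Module.jacobson_quotient_jacobson Λ Λ)
  obtain ⟨s, hs⟩ := IsSemisimpleModule.lifting_property
    (Submodule.factor (Ring.jacobson_le_of_isMaximal m)) (Submodule.factor_surjective _)
    e.toLinearMap
  have : Function.Injective s :=
    .of_comp (f := Submodule.factor _) (by rw [← LinearMap.coe_comp, hs]; exact e.injective)
  exact ⟨_, ⟨.ofInjective s this⟩⟩

variable (Λ) in
/-- Isomorphism of simple `Λ`-modules. -/
def simpleSetoid : Setoid {S : ModuleCat.{u} Λ // Simple S} :=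
  (isIsomorphicSetoid (ModuleCat.{u} Λ)).comap Subtype.val

theorem finite_quotient_simpleSetoid [IsArtinianRing Λ] : Finite (Quotient (simpleSetoid Λ)) := by
  have h (S : {S : ModuleCat.{u} Λ // Simple S}) := have := S.2
    exists_linearEquiv_submodule_quotient_jacobson (Λ := Λ) S.1
  choose N e using h
  have hN S : IsSimpleModule Λ (N S) := have := S.2; .congr (e S).some.symm
  let c S : isotypicComponents Λ (Λ ⧸ Ring.jacobson Λ) :=
    ⟨isotypicComponent Λ _ (N S), N S, hN S, rfl⟩
  refine Finite.of_injective (fun q => c q.out) fun q q' h => ?_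
  have hle : N q.out ≤ isotypicComponent Λ _ (N q'.out) :=
    (N q.out).le_isotypicComponent.trans_eq (congrArg Subtype.val h)
  obtain ⟨e'⟩ := isIsotypicOfType_submodule_iff.1
    (IsIsotypicOfType.isotypicComponent Λ _ (N q'.out)) _ hle
  rw [← Quotient.out_equiv_out]
  exact ⟨((e _).some.trans (e'.trans (e _).some.symm)).toModuleIso⟩

theorem exists_rel_of_total_of_injective {α : Type*} (s : Setoid α) [Finite (Quotient s)]
    (r : α → α → Prop) (htot : ∀ a, ∃ b, r a b)
    (hinj : ∀ {a a' b b'}, r a b → r a' b' → s b b' → s a a') (t : α) : ∃ a b, r a b ∧ s b t := by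
  choose f hf using htot
  have hg : Function.Injective fun q : Quotient s => Quotient.mk s (f q.out) := fun p q hpq =>
    Quotient.out_equiv_out.1 (hinj (hf p.out) (hf q.out) (Quotient.exact hpq))
  obtain ⟨q, hq⟩ := Finite.surjective_of_injective hg (Quotient.mk s t)
  exact ⟨_, _, hf q.out, Quotient.exact hq⟩

end FiniteLength

section Prinj

variable {Λ : Type u} [Ring Λ]

theorem prinj_le_isProjective : prinj Λ ≤ isProjective (ModuleCat.{u} Λ) := fun P hP =>
  have := hP.2.1
  show Projective P from inferInstance

theorem prinj_le_isInjective : prinj Λ ≤ isInjective (ModuleCat.{u} Λ) := fun P hP =>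
  have := hP.2.2
  Module.injective_object_of_injective_module Λ P

theorem finite_of_retract {P Q : ModuleCat.{u} Λ} (r : Retract P Q) [Module.Finite Λ Q] :
    Module.Finite Λ P :=
  .of_surjective r.r.hom fun x => ⟨r.i x, congr($(r.retract) x)⟩

theorem prinj_of_retract {P Q : ModuleCat.{u} Λ} (r : Retract P Q) (hQ : prinj Λ Q) :
    prinj Λ P := by
  have := hQ.1
  have : Projective Q := prinj_le_isProjective _ hQ
  have : Injective Q := prinj_le_isInjective _ hQ
  have := r.injective
  exact ⟨finite_of_retract r, (IsProjective.iff_projective P).2 r.projective,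
    Module.injective_module_of_injective_object Λ P⟩

theorem prinj_prod {P Q : ModuleCat.{u} Λ} (hP : prinj Λ P) (hQ : prinj Λ Q) :
    prinj Λ (ModuleCat.of Λ (P × Q)) := by
  obtain ⟨_, _, hP⟩ := hP
  obtain ⟨_, _, hQ⟩ := hQ
  refine ⟨inferInstanceAs (Module.Finite Λ (P × Q)),
    inferInstanceAs (Module.Projective Λ (P × Q)), ⟨fun X Y _ _ _ _ f hf g => ?_⟩⟩
  obtain ⟨a, ha⟩ := hP.out f hf (LinearMap.fst Λ P Q ∘ₗ g)
  obtain ⟨b, hb⟩ := hQ.out f hf (LinearMap.snd Λ P Q ∘ₗ g)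
  exact ⟨a.prod b, fun x => Prod.ext (ha x) (hb x)⟩

theorem prinj_punit : prinj Λ (ModuleCat.of Λ PUnit) :=
  ⟨inferInstanceAs (Module.Finite Λ PUnit.{u + 1}),
    inferInstanceAs (Module.Projective Λ PUnit.{u + 1}),
    ⟨fun _ _ _ _ _ _ _ _ _ => ⟨0, fun _ => rfl⟩⟩⟩

theorem exists_mono_prinj (X : ModuleCat.{u} Λ) [IsArtinian Λ X]
    (h : ∀ S : Submodule Λ X, IsSimpleModule Λ S →
      ∃ Q : ModuleCat.{u} Λ, prinj Λ Q ∧ ∃ f : ModuleCat.of Λ S ⟶ Q, f ≠ 0) :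
    ∃ Q : ModuleCat.{u} Λ, prinj Λ Q ∧ ∃ f : X ⟶ Q, Mono f := by
  obtain ⟨_, ⟨Q, hQ, f, rfl⟩, hmin⟩ := IsArtinian.set_has_minimal
    {K : Submodule Λ X | ∃ Q : ModuleCat.{u} Λ, prinj Λ Q ∧ ∃ f : X →ₗ[Λ] Q, LinearMap.ker f = K}
    ⟨_, _, prinj_punit, 0, rfl⟩
  refine ⟨Q, hQ, ModuleCat.ofHom f, (ModuleCat.mono_iff_ker_eq_bot _).2 ?_⟩
  obtain hbot | ⟨S, hS, hSf⟩ := eq_bot_or_exists_atom_le (LinearMap.ker f)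
  · exact hbot
  obtain ⟨Q', hQ', g, hg⟩ := h S (isSimpleModule_iff_isAtom.2 hS)
  obtain ⟨g', hg'⟩ := hQ'.2.2.out S.subtype S.injective_subtype g.hom
  refine (hmin (LinearMap.ker (f.prod g')) ⟨_, prinj_prod hQ hQ', _, rfl⟩ ?_).elim
  rw [LinearMap.ker_prod]
  refine inf_le_left.lt_of_ne fun heq => hg (ModuleCat.hom_ext (LinearMap.ext fun x => ?_))
  have hx : (x : X) ∈ LinearMap.ker g' := inf_eq_left.1 heq (hSf x.2)
  exact (hg' x).symm.trans hx

end Prinj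

section FiniteLengthExt

variable {Λ : Type u} [Ring Λ]

theorem subsingleton_ext_of_isFiniteLength {Y : ModuleCat.{u} Λ} {i : ℕ}
    (h : ∀ T : ModuleCat.{u} Λ, Simple T → Subsingleton (Ext T Y i)) {M : Type u}
    [AddCommGroup M] [Module Λ M] (hM : IsFiniteLength Λ M) :
    Subsingleton (Ext (ModuleCat.of Λ M) Y i) := by
  induction hM with
  | of_subsingleton =>
    refine subsingleton_of_forall_eq 0 fun z => ?_
    rw [← Ext.mk₀_id_comp z, (ModuleCat.isZero_of_subsingleton _).eq_of_src (𝟙 _) 0,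
      Ext.mk₀_zero, Ext.zero_comp]
  | @of_simple_quotient M _ _ N _ _ ih =>
    have hS := ModuleCat.shortComplex_shortExact
      (ModuleCat.shortComplexOfCompEqZero N.subtype N.mkQ (by ext; simp))
      (LinearMap.exact_subtype_mkQ N) N.injective_subtype N.mkQ_surjective
    have : Subsingleton (Ext (ModuleCat.of Λ (M ⧸ N)) Y i) := h _ inferInstance
    exact subsingleton_ext_X₂ hS

theorem exists_simple_ext_ne_zero [IsArtinianRing Λ] {M Y : ModuleCat.{u} Λ} [Module.Finite Λ M]
    {i : ℕ} {x : Ext M Y i} (hx : x ≠ 0) :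
    ∃ T : ModuleCat.{u} Λ, Simple T ∧ ∃ y : Ext T Y i, y ≠ 0 := by
  by_contra! h
  have := subsingleton_ext_of_isFiniteLength (fun T hT => subsingleton_of_forall_eq 0 (h T hT))
    (isFiniteLength_iff_isNoetherian_isArtinian (M := M).2 ⟨inferInstance, inferInstance⟩)
  exact hx (Subsingleton.elim (α := Ext (ModuleCat.of Λ M) Y i) x 0)

end FiniteLengthExt

section DominantDimension

variable {Λ : Type u} [Ring Λ]

theorem shortExact_rangeRestrict {A B C : Type u} [AddCommGroup A] [Module Λ A] [AddCommGroup B]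
    [Module Λ B] [AddCommGroup C] [Module Λ C] {f : A →ₗ[Λ] B} {g : B →ₗ[Λ] C}
    (hf : Function.Injective f) (hfg : Function.Exact f g) :
    (ModuleCat.shortComplexOfCompEqZero f g.rangeRestrict
      (LinearMap.ext fun x => Subtype.ext (hfg.apply_apply_eq_zero x))).ShortExact :=
  ModuleCat.shortComplex_shortExact _ (fun y => Subtype.ext_iff.trans (hfg y)) hf
    g.surjective_rangeRestrict

namespace MinimalInjectiveCoresolution

variable {M : Type u} [AddCommGroup M] [Module Λ M]

theorem exists_isCosyzygyClass (I : MinimalInjectiveCoresolution Λ M) (k : ℕ)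
    (h : ∀ j ≤ k, Module.Projective Λ (I.term j)) :
    ∃ ξ : Ext (ModuleCat.of Λ (LinearMap.range (I.d k))) (ModuleCat.of Λ M) (k + 1),
      IsCosyzygyClass (prinj Λ) _ ξ := by
  have hJ : prinj Λ (I.term k) := ⟨I.finite k, h k le_rfl, I.injective k⟩
  induction k with
  | zero =>
    exact ⟨_, .succ (shortExact_rangeRestrict I.aug_injective I.exact_zero) hJ .zero⟩
  | succ k ih =>
    obtain ⟨ξ, hξ⟩ := ih (fun j hj => h j (by omega))
      ⟨I.finite k, h k k.le_succ, I.injective k⟩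
    have hexact : Function.Exact (LinearMap.range (I.d k)).subtype (I.d (k + 1)) := by
      rw [LinearMap.exact_iff, Submodule.range_subtype, LinearMap.exact_iff.1 (I.exact_succ k)]
    exact ⟨_, .succ (shortExact_rangeRestrict (Submodule.injective_subtype _) hexact) hJ hξ⟩

end MinimalInjectiveCoresolution

namespace IsMinimalAuslanderGorenstein

variable {n : ℕ}

theorem hasInjectiveDimensionLT (h : IsMinimalAuslanderGorenstein Λ n) :
    HasInjectiveDimensionLT (ModuleCat.of Λ Λ) (n + 2) :=
  (injectiveDimension_le_iff _ _).1 h.1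

theorem exists_isCosyzygyClass (h : IsMinimalAuslanderGorenstein Λ n) :
    ∃ (C : ModuleCat.{u} Λ) (ξ : Ext C (ModuleCat.of Λ Λ) (n + 1)),
      IsCosyzygyClass (prinj Λ) _ ξ ∧ Module.Finite Λ C ∧ Injective C := by
  have hlt : (n : ℕ∞) < dominantDimension Λ :=
    (ENat.natCast_lt_natCast.2 n.lt_succ_self).trans_le h.2
  obtain ⟨_, ⟨m, rfl, I, hI⟩, hm⟩ := lt_sSup_iff.1 hlt
  obtain ⟨ξ, hξ⟩ := I.exists_isCosyzygyClass n fun j hj =>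
    hI j (hj.trans_lt (ENat.natCast_lt_natCast.1 hm))
  have := I.finite n
  have : HasInjectiveDimensionLT (ModuleCat.of Λ Λ) (n + 1 + 0 + 1) := h.hasInjectiveDimensionLT
  exact ⟨_, ξ, hξ, inferInstanceAs (Module.Finite Λ (LinearMap.range (I.d n))),
    injective_iff_hasInjectiveDimensionLT_one.2
      (hξ.hasInjectiveDimensionLT prinj_le_isInjective (m := 0))⟩

end IsMinimalAuslanderGorenstein

end DominantDimension

section SimpleModules

variable {Λ : Type u} [Ring Λ] {n : ℕ}

theorem isLocalRing_end {M : ModuleCat.{u} Λ} [IsLocalRing (Module.End Λ M)] :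
    IsLocalRing (End M) where
  toNontrivial := (ModuleCat.endRingEquiv M).toEquiv.nontrivial
  isUnit_or_isUnit_of_add_one h := by
    have h' := congr(ModuleCat.endRingEquiv M $h)
    rw [map_add, map_one] at h'
    simpa only [MulEquiv.isUnit_map] using IsLocalRing.isUnit_or_isUnit_of_add_one h'

theorem exists_retract_isLocalRing_end [IsArtinianRing Λ] (S : ModuleCat.{u} Λ) [Simple S] :
    ∃ P : ModuleCat.{u} Λ, Nonempty (Retract P (ModuleCat.of Λ Λ)) ∧ IsLocalRing (End P) ∧
      ∃ p : P ⟶ S, p ≠ 0 := by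
  have := IsSimpleModule.nontrivial Λ S
  obtain ⟨s, hs⟩ := exists_ne (0 : S)
  have hker : LinearMap.ker (LinearMap.toSpanSingleton Λ S s) ≠ ⊤ := fun h =>
    hs (by simpa using LinearMap.congr_fun (LinearMap.ker_eq_top.1 h) 1)
  obtain ⟨K, K', hK, hKs, _⟩ := exists_isCompl_isLocalRing_end hker
  refine ⟨ModuleCat.of Λ K, ⟨⟨ModuleCat.ofHom K.subtype,
    ModuleCat.ofHom (Submodule.projectionOnto K K' hK), ?_⟩⟩,
    isLocalRing_end (M := .of Λ K),
    ModuleCat.ofHom (LinearMap.toSpanSingleton Λ S s ∘ₗ K.subtype), fun h => hKs ?_⟩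
  · ext x
    simp
  · exact fun x hx => congr($h ⟨x, hx⟩)

/-- The simple modules `S` and `T` correspond to the two ends of an indecomposable direct summand
`P` of `Λ`: `S` is a quotient of `P`, and `T` is a submodule of `P` if `P` is injective, and a
submodule of the `(n + 1)`-st cosyzygy of `P`, expressed by means of `Ext`, if it is not. -/
def TopSocleRel (n : ℕ) (S T : ModuleCat.{u} Λ) : Prop :=
  ∃ P : ModuleCat.{u} Λ, Nonempty (Retract P (ModuleCat.of Λ Λ)) ∧ IsLocalRing (End P) ∧
    (∃ p : P ⟶ S, p ≠ 0) ∧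
      ((prinj Λ P ∧ ∃ x : Ext T P 0, x ≠ 0) ∨ ∃ x : Ext T P (n + 1), x ≠ 0)

namespace IsMinimalAuslanderGorenstein

theorem exists_ext_ne_zero_of_not_prinj (hΛ : IsMinimalAuslanderGorenstein Λ n)
    {P : ModuleCat.{u} Λ} (r : Retract P (ModuleCat.of Λ Λ)) (hP : ¬ prinj Λ P) :
    ∃ C : ModuleCat.{u} Λ, Module.Finite Λ C ∧ ∃ x : Ext C P (n + 1), x ≠ 0 := by
  obtain ⟨C, ξ, hξ, hC, -⟩ := hΛ.exists_isCosyzygyClass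
  refine ⟨C, hC, ξ.comp (Ext.mk₀ r.r) (add_zero _), fun h => hP ?_⟩
  obtain ⟨Q, hQ, b, c, hbc⟩ :=
    hξ.exists_factorization_of_comp_mk₀_eq_zero prinj_le_isProjective r.r h
  exact prinj_of_retract ⟨r.i ≫ b, c, by rw [Category.assoc, hbc, r.retract]⟩ hQ

theorem exists_topSocleRel [IsArtinianRing Λ] (hΛ : IsMinimalAuslanderGorenstein Λ n)
    (S : ModuleCat.{u} Λ) [Simple S] :
    ∃ T : ModuleCat.{u} Λ, Simple T ∧ TopSocleRel n S T := by
  obtain ⟨P, ⟨r⟩, hlocal, p, hp⟩ := exists_retract_isLocalRing_end S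
  by_cases hP : prinj Λ P
  · have hid : Ext.mk₀ (𝟙 P) ≠ 0 := fun h =>
      hp (by rw [← Category.id_comp p, Ext.mk₀_eq_zero_iff _ |>.1 h, Limits.zero_comp])
    have := hP.1
    obtain ⟨T, hT, x, hx⟩ := exists_simple_ext_ne_zero hid
    exact ⟨T, hT, P, ⟨r⟩, hlocal, ⟨p, hp⟩, .inl ⟨hP, x, hx⟩⟩
  · obtain ⟨C, hC, x, hx⟩ := hΛ.exists_ext_ne_zero_of_not_prinj r hP
    obtain ⟨T, hT, x, hx⟩ := exists_simple_ext_ne_zero hx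
    exact ⟨T, hT, P, ⟨r⟩, hlocal, ⟨p, hp⟩, .inr ⟨x, hx⟩⟩

theorem subsingleton_ext_of_mono (hΛ : IsMinimalAuslanderGorenstein Λ n) {M P Y : ModuleCat.{u} Λ}
    (i : M ⟶ P) [Mono i] [Projective P] (r : Retract Y (ModuleCat.of Λ Λ)) {k : ℕ}
    (hk : n + 1 ≤ k) : Subsingleton (Ext M Y k) := by
  have := hΛ.hasInjectiveDimensionLT
  have := r.hasInjectiveDimensionLT (n + 2)
  exact subsingleton_ext_of_mono_of_projective i hk

theorem ext_eq_zero_of_ext_zero_ne_zero (hΛ : IsMinimalAuslanderGorenstein Λ n)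
    {T P Y : ModuleCat.{u} Λ} [Simple T] [Projective P] {x : Ext T P 0} (hx : x ≠ 0)
    (r : Retract Y (ModuleCat.of Λ Λ)) (y : Ext T Y (n + 1)) : y = 0 := by
  obtain ⟨i, rfl⟩ := (Ext.mk₀_bijective _ _).2 x
  have : Mono i := mono_of_nonzero_from_simple fun h => hx (by rw [h, Ext.mk₀_zero])
  have := hΛ.subsingleton_ext_of_mono i r le_rfl
  exact Subsingleton.elim y 0

theorem nonempty_iso_of_topSocleRel (hΛ : IsMinimalAuslanderGorenstein Λ n)
    {S₁ S₂ T₁ T₂ : ModuleCat.{u} Λ} [Simple S₁] [Simple S₂] [Simple T₁]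
    (h₁ : TopSocleRel n S₁ T₁) (h₂ : TopSocleRel n S₂ T₂) (e : T₁ ≅ T₂) :
    Nonempty (S₁ ≅ S₂) := by
  have transport {Y : ModuleCat.{u} Λ} {k : ℕ} (h : ∃ x : Ext T₂ Y k, x ≠ 0) :
      ∃ x : Ext T₁ Y k, x ≠ 0 := by
    obtain ⟨x, hx⟩ := h
    refine ⟨(Ext.mk₀ e.hom).comp x (zero_add k), fun h => hx ?_⟩
    simpa using congr((Ext.mk₀ e.inv).comp $h (zero_add k))
  obtain ⟨C, ξ, hξ, -, hC⟩ := hΛ.exists_isCosyzygyClass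
  obtain ⟨P₁, ⟨r₁⟩, _, ⟨p₁, hp₁⟩, h₁⟩ := h₁
  obtain ⟨P₂, ⟨r₂⟩, _, ⟨p₂, hp₂⟩, h₂⟩ := h₂
  have := r₁.projective
  have := r₂.projective
  replace h₂ := h₂.imp (And.imp_right transport) transport
  obtain ⟨hP₁, x₁, hx₁⟩ | ⟨x₁, hx₁⟩ := h₁ <;> obtain ⟨hP₂, x₂, hx₂⟩ | ⟨x₂, hx₂⟩ := h₂
  · have : Injective P₁ := prinj_le_isInjective _ hP₁
    have : Injective P₂ := prinj_le_isInjective _ hP₂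
    exact nonempty_iso_of_ext_ne_zero prinj_le_isInjective prinj_le_isProjective .zero .zero
      (.refl P₁) (.refl P₂) hx₁ hx₂ hp₁ hp₂
  · exact (hx₂ (hΛ.ext_eq_zero_of_ext_zero_ne_zero hx₁ r₂ x₂)).elim
  · exact (hx₁ (hΛ.ext_eq_zero_of_ext_zero_ne_zero hx₂ r₁ x₁)).elim
  · exact nonempty_iso_of_ext_ne_zero prinj_le_isInjective prinj_le_isProjective hξ hξ
      r₁ r₂ hx₁ hx₂ hp₁ hp₂

theorem exists_prinj_or_ext_ne_zero [IsArtinianRing Λ] (hΛ : IsMinimalAuslanderGorenstein Λ n)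
    (T : ModuleCat.{u} Λ) [Simple T] :
    (∃ Q : ModuleCat.{u} Λ, prinj Λ Q ∧ ∃ f : T ⟶ Q, f ≠ 0) ∨
      ∃ x : Ext T (ModuleCat.of Λ Λ) (n + 1), x ≠ 0 := by
  have := finite_quotient_simpleSetoid (Λ := Λ)
  obtain ⟨S, T', ⟨P, ⟨r⟩, -, -, h⟩, ⟨e⟩⟩ := exists_rel_of_total_of_injective (simpleSetoid Λ)
    (fun S T => TopSocleRel n S.1 T.1)
    (fun ⟨S, _⟩ => (hΛ.exists_topSocleRel S).elim fun T h => ⟨⟨T, h.1⟩, h.2⟩)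
    (fun {S S' T T'} h h' ⟨e⟩ => have := S.2; have := S'.2; have := T.2
      hΛ.nonempty_iso_of_topSocleRel h h' e) ⟨T, ‹_›⟩
  refine h.imp (fun ⟨hP, x, hx⟩ => ⟨P, hP, ?_⟩) fun ⟨x, hx⟩ =>
    ⟨(Ext.mk₀ e.inv).comp (x.comp (Ext.mk₀ r.i) (add_zero _)) (zero_add _), fun h₀ => hx ?_⟩
  · obtain ⟨i, rfl⟩ := (Ext.mk₀_bijective _ _).2 x
    refine ⟨e.inv ≫ i, fun h₀ => hx ?_⟩
    rw [(cancel_epi e.inv).1 (h₀.trans Limits.comp_zero.symm), Ext.mk₀_zero]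
  · simpa using congr((Ext.mk₀ e.hom).comp (($h₀).comp (Ext.mk₀ r.r) (add_zero _)) (zero_add _))

theorem exists_mono_prinj_of_subsingleton_ext [IsArtinianRing Λ]
    (hΛ : IsMinimalAuslanderGorenstein Λ n) (D : ModuleCat.{u} Λ) [Module.Finite Λ D]
    [Subsingleton (Ext D (ModuleCat.of Λ Λ) (n + 1))] :
    ∃ Q : ModuleCat.{u} Λ, prinj Λ Q ∧ ∃ f : D ⟶ Q, Mono f := by
  obtain ⟨C, ξ, hξ, -, hC⟩ := hΛ.exists_isCosyzygyClass
  refine exists_mono_prinj D fun T _ => (hΛ.exists_prinj_or_ext_ne_zero (.of Λ T)).resolve_right ?_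
  rintro ⟨x, hx⟩
  obtain ⟨i, rfl⟩ := hξ.exists_comp_eq prinj_le_isInjective (zero_add _) x
  obtain ⟨i, rfl⟩ := (Ext.mk₀_bijective _ _).2 i
  have : Mono (ModuleCat.ofHom T.subtype) :=
    (ModuleCat.mono_iff_injective _).2 T.injective_subtype
  refine hx ?_
  rw [← Injective.comp_factorThru i (ModuleCat.ofHom T.subtype), ← Ext.mk₀_comp_mk₀_assoc,
    Subsingleton.elim ((Ext.mk₀ _).comp ξ _) 0, Ext.comp_zero]

end IsMinimalAuslanderGorenstein

end SimpleModules

section HomExactExtension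

variable {Λ : Type u} [Ring Λ]

theorem exists_comp_eq_of_exact {A B C D : Type*} [AddCommGroup A] [Module Λ A] [AddCommGroup B]
    [Module Λ B] [AddCommGroup C] [Module Λ C] [AddCommGroup D] [Module Λ D] {f : A →ₗ[Λ] B}
    {g : B →ₗ[Λ] C} (hfg : Function.Exact f g) (hg : Function.Surjective g) {q : B →ₗ[Λ] D}
    (hq : q ∘ₗ f = 0) : ∃ q' : C →ₗ[Λ] D, q' ∘ₗ g = q := by
  refine ⟨(LinearMap.range f).liftQ q (LinearMap.range_le_ker_iff.2 hq) ∘ₗ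
    (hfg.linearEquivOfSurjective hg).symm, LinearMap.ext fun x => ?_⟩
  simp

/-- There is a short exact sequence `0 → X → T → Y → 0` with `T` finitely generated projective
that stays exact under `Hom_Λ(-, Λ)`. Totally acyclic complexes are spliced from these. -/
def IsHomExactExtension (X Y : ModuleCat.{u} Λ) : Prop :=
  ∃ (T : ModuleCat.{u} Λ) (f : X →ₗ[Λ] T) (g : T →ₗ[Λ] Y), Module.Finite Λ T ∧
    Module.Projective Λ T ∧ Function.Injective f ∧ Function.Exact f g ∧ Function.Surjective g ∧
      ∀ h : X →ₗ[Λ] Λ, ∃ h' : T →ₗ[Λ] Λ, h' ∘ₗ f = h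

theorem IsHomExactExtension.of_shortExact {S : ShortComplex (ModuleCat.{u} Λ)}
    (hS : S.ShortExact) [Module.Finite Λ S.X₂] [Projective S.X₂]
    [Subsingleton (Ext S.X₃ (ModuleCat.of Λ Λ) 1)] : IsHomExactExtension S.X₁ S.X₃ := by
  refine ⟨S.X₂, S.f.hom, S.g.hom, ‹_›, (IsProjective.iff_projective S.X₂).2 ‹_›,
    hS.moduleCat_injective_f,
    (ShortComplex.ShortExact.moduleCat_exact_iff_function_exact S).1 hS.exact,
    hS.moduleCat_surjective_g, fun h => ?_⟩
  obtain ⟨h', hh'⟩ := (subsingleton_ext_one_iff hS).1 ‹_› (ModuleCat.ofHom h)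
  exact ⟨h'.hom, congr(($hh').hom)⟩

theorem isGorensteinProjective_of_sequence (Z : ℤ → ModuleCat.{u} Λ)
    (hZ : ∀ i, IsHomExactExtension (Z i) (Z (i + 1))) : IsGorensteinProjective Λ (Z 0) := by
  choose T f g hfin hproj hf hfg hg hext using hZ
  have hexact i : Function.Exact (f i) (f (i + 1) ∘ₗ g i) :=
    (hf (i + 1)).comp_exact_iff_exact.2 (hfg i)
  refine ⟨⟨T, fun i => f (i + 1) ∘ₗ g i, hfin, hproj,
    fun i => (hg i).comp_exact_iff_exact.2 (hexact (i + 1)), fun i q hq => ?_⟩,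
    ⟨(LinearEquiv.ofInjective (f 0) (hf 0)).trans
      (LinearEquiv.ofEq _ _ (hexact 0).linearMap_ker_eq.symm)⟩⟩
  have hq' : q ∘ₗ f (i + 1) = 0 := by
    rwa [← LinearMap.comp_assoc, ← LinearMap.zero_comp (g i), LinearMap.cancel_right (hg i)] at hq
  obtain ⟨q, rfl⟩ := exists_comp_eq_of_exact (hfg (i + 1)) (hg (i + 1)) hq'
  obtain ⟨q, rfl⟩ := hext (i + 1 + 1) q
  exact ⟨q, rfl⟩

theorem isGorensteinProjective_of_closed (W : ModuleCat.{u} Λ → Prop)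
    (hl : ∀ X, W X → ∃ Y, W Y ∧ IsHomExactExtension Y X)
    (hr : ∀ X, W X → ∃ Y, W Y ∧ IsHomExactExtension X Y) {X : ModuleCat.{u} Λ} (hX : W X) :
    IsGorensteinProjective Λ X := by
  choose L hLW hL using hl
  choose R hRW hR using hr
  let l (n : ℕ) : {X // W X} := (fun Y => ⟨L Y.1 Y.2, hLW Y.1 Y.2⟩)^[n] ⟨X, hX⟩
  let r (n : ℕ) : {X // W X} := (fun Y => ⟨R Y.1 Y.2, hRW Y.1 Y.2⟩)^[n] ⟨X, hX⟩
  let Z : ℤ → ModuleCat.{u} Λ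
    | Int.ofNat n => (r n).1
    | Int.negSucc n => (l (n + 1)).1
  have hl n : IsHomExactExtension (l (n + 1)).1 (l n).1 := by
    simp only [l, Function.iterate_succ_apply']
    exact hL _ _
  have hr n : IsHomExactExtension (r n).1 (r (n + 1)).1 := by
    simp only [r, Function.iterate_succ_apply']
    exact hR _ _
  refine isGorensteinProjective_of_sequence Z fun i => ?_
  match i with
  | Int.ofNat n => exact hr n
  | Int.negSucc 0 => exact hl 0
  | Int.negSucc (n + 1) => exact hl (n + 1)

end HomExactExtension

section GorensteinProjective

variable {Λ : Type u} [Ring Λ]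

namespace TotallyAcyclicComplex

theorem shortExact (P : TotallyAcyclicComplex Λ) (i : ℤ) :
    (ModuleCat.shortComplexOfCompEqZero (LinearMap.ker (P.d i)).subtype (P.d i).rangeRestrict
      (LinearMap.ext fun x => Subtype.ext x.2)).ShortExact :=
  shortExact_rangeRestrict (Submodule.injective_subtype _) (LinearMap.exact_subtype_ker_map _)

theorem projective_term (P : TotallyAcyclicComplex Λ) (i : ℤ) : Projective (P.term i) :=
  (IsProjective.iff_projective _).1 (P.projective i)

theorem subsingleton_ext_one (P : TotallyAcyclicComplex Λ) (i : ℤ) :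
    Subsingleton
      (Ext (ModuleCat.of Λ (LinearMap.range (P.d (i + 1 + 1)))) (ModuleCat.of Λ Λ) 1) := by
  have := P.projective_term (i + 1 + 1)
  refine (subsingleton_ext_one_iff (P.shortExact _)).2 fun f => ?_
  let d : P.term (i + 1) →ₗ[Λ] LinearMap.ker (P.d (i + 1 + 1)) :=
    (P.d (i + 1)).codRestrict _ (P.exact (i + 1)).apply_apply_eq_zero
  obtain ⟨g, hg⟩ := P.hom_exact i (f.hom ∘ₗ d) <| LinearMap.ext fun x => by
    have hx : d (P.d i x) = 0 := Subtype.ext ((P.exact i).apply_apply_eq_zero x)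
    exact congr(f.hom $hx).trans (map_zero _)
  refine ⟨ModuleCat.ofHom g, ModuleCat.hom_ext (LinearMap.ext fun ⟨x, hx⟩ => ?_)⟩
  obtain ⟨y, rfl⟩ := (P.exact (i + 1) x).1 hx
  exact congr($hg y)

theorem subsingleton_ext (P : TotallyAcyclicComplex Λ) (k : ℕ) (i : ℤ) :
    Subsingleton (Ext (ModuleCat.of Λ (LinearMap.ker (P.d i))) (ModuleCat.of Λ Λ) (k + 1)) := by
  induction k generalizing i with
  | zero =>
    obtain ⟨i, rfl⟩ : ∃ j : ℤ, i = j + 1 + 1 + 1 := ⟨i - 3, by omega⟩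
    rw [(P.exact _).linearMap_ker_eq]
    exact P.subsingleton_ext_one i
  | succ k ih =>
    obtain ⟨i, rfl⟩ : ∃ j : ℤ, i = j + 1 := ⟨i - 1, by omega⟩
    rw [(P.exact i).linearMap_ker_eq]
    have := ih i
    have := P.projective_term i
    have := Ext.subsingleton_of_projective (P.term i) (ModuleCat.of Λ Λ) (k + 1)
    exact subsingleton_ext_X₃ (P.shortExact i)

end TotallyAcyclicComplex

variable {M : Type u} [AddCommGroup M] [Module Λ M]

theorem IsGorensteinProjective.subsingleton_ext (hM : IsGorensteinProjective Λ M) (k : ℕ) :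
    Subsingleton (Ext (ModuleCat.of Λ M) (ModuleCat.of Λ Λ) (k + 1)) := by
  obtain ⟨P, ⟨e⟩⟩ := hM
  have := P.subsingleton_ext k 0
  exact subsingleton_ext_of_retract (.ofIso e.toModuleIso)

theorem HasGorensteinProjectiveResolution.subsingleton_ext {m : ℕ}
    (hM : HasGorensteinProjectiveResolution Λ m M) {k : ℕ} (hk : m ≤ k) :
    Subsingleton (Ext (ModuleCat.of Λ M) (ModuleCat.of Λ Λ) (k + 1)) := by
  induction m generalizing M k with
  | zero => exact IsGorensteinProjective.subsingleton_ext hM k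
  | succ m ih =>
    obtain ⟨K, G, i, p, hi, hip, hp, hG, hK⟩ := hM
    obtain ⟨k, rfl⟩ : ∃ l, k = l + 1 := ⟨k - 1, by omega⟩
    have := ih hK (k := k) (by omega)
    have := hG.subsingleton_ext (k + 1)
    exact subsingleton_ext_X₃ (ModuleCat.shortComplex_shortExact
      (ModuleCat.shortComplexOfCompEqZero i p hip.linearMap_comp_eq_zero) hip hi hp)

theorem gpd_le_iff {n : ℕ} :
    Gpd Λ M ≤ n ↔ ∃ m ≤ n, HasGorensteinProjectiveResolution Λ m M := by
  constructor
  · intro h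
    have hlt : Gpd Λ M < (n + 1 : ℕ) := h.trans_lt (ENat.natCast_lt_natCast.2 n.lt_succ_self)
    obtain ⟨_, ⟨m, rfl, hm⟩, hmn⟩ := sInf_lt_iff.1 hlt
    exact ⟨m, Nat.lt_succ_iff.1 (ENat.natCast_lt_natCast.1 hmn), hm⟩
  · rintro ⟨m, hmn, hm⟩
    exact sInf_le_of_le ⟨m, rfl, hm⟩ (ENat.natCast_le_natCast.2 hmn)

end GorensteinProjective

section Approximation

variable {Λ : Type u} [Ring Λ]

theorem isNoetherian_linearMap_of_smulCommClass {A X Y : Type*} [Ring A] [AddCommGroup X]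
    [Module Λ X] [Module.Finite Λ X] [AddCommGroup Y] [Module Λ Y] [Module A Y]
    [SMulCommClass Λ A Y] [IsNoetherian A Y] : IsNoetherian A (X →ₗ[Λ] Y) := by
  obtain ⟨k, p, hp⟩ := Module.Finite.exists_fin' Λ X
  let ev : (X →ₗ[Λ] Y) →ₗ[A] (Fin k → Y) :=
    { toFun := fun h i => h (p (Pi.single i 1))
      map_add' := fun _ _ => rfl
      map_smul' := fun _ _ => rfl }
  refine isNoetherian_of_injective ev fun g h hgh => ?_
  rw [← LinearMap.cancel_right hp]
  exact LinearMap.pi_ext' fun i => LinearMap.ext_ring congr($hgh i)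

theorem exists_left_approximation (A : Type*) {X Y : Type*} [Semiring A] [AddCommGroup X]
    [Module Λ X] [AddCommGroup Y] [Module Λ Y] [Module A Y] [SMulCommClass Λ A Y]
    [Module.Finite A (X →ₗ[Λ] Y)] :
    ∃ (m : ℕ) (f : X →ₗ[Λ] (Fin m → Y)), ∀ h : X →ₗ[Λ] Y, ∃ h' : (Fin m → Y) →ₗ[Λ] Y,
      h' ∘ₗ f = h := by
  obtain ⟨m, q, hq⟩ := Module.Finite.exists_fin (R := A) (M := X →ₗ[Λ] Y)
  refine ⟨m, LinearMap.pi q, fun h => ?_⟩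
  obtain ⟨c, rfl⟩ := (Submodule.mem_span_range_iff_exists_fun A).1 (hq ▸ Submodule.mem_top (x := h))
  exact ⟨∑ i, c i • LinearMap.proj i, by ext; simp⟩

theorem injective_of_forall_exists_comp_eq {X T Q : Type*} [AddCommGroup X] [Module Λ X]
    [AddCommGroup T] [Module Λ T] [AddCommGroup Q] [Module Λ Q] [Module.Projective Λ Q]
    {i : X →ₗ[Λ] Q} (hi : Function.Injective i) {f : X →ₗ[Λ] T}
    (hf : ∀ h : X →ₗ[Λ] Λ, ∃ h' : T →ₗ[Λ] Λ, h' ∘ₗ f = h) : Function.Injective f := by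
  refine (injective_iff_map_eq_zero f).2 fun x hx => ?_
  by_contra hx₀
  obtain ⟨h, hh⟩ := Module.Projective.exists_dual_ne_zero Λ ((map_ne_zero_iff i hi).2 hx₀)
  obtain ⟨h', hh'⟩ := hf (h ∘ₗ i)
  exact hh (by rw [← LinearMap.comp_apply, ← hh', LinearMap.comp_apply, hx, map_zero])

/-- Finitely generated modules without extensions of positive degree by `Λ`. Over a minimal
Auslander-Gorenstein algebra they turn out to be the Gorenstein projective modules. -/
structure IsExtOrthogonal (X : ModuleCat.{u} Λ) : Prop where
  finite : Module.Finite Λ X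
  subsingleton_ext (k : ℕ) : Subsingleton (Ext X (ModuleCat.of Λ Λ) (k + 1))

theorem isExtOrthogonal_of_projective (X : ModuleCat.{u} Λ) [Module.Finite Λ X] [Projective X] :
    IsExtOrthogonal X :=
  ⟨‹_›, fun k => Ext.subsingleton_of_projective X _ k⟩

theorem exists_shortExact_projective [IsNoetherianRing Λ] (X : ModuleCat.{u} Λ)
    [Module.Finite Λ X] :
    ∃ (K P : ModuleCat.{u} Λ) (i : K ⟶ P) (p : P ⟶ X) (w : i ≫ p = 0),
      (ShortComplex.mk i p w).ShortExact ∧ Module.Finite Λ K ∧ Module.Finite Λ P ∧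
        Projective P := by
  obtain ⟨k, p, hp⟩ := Module.Finite.exists_fin' Λ X
  exact ⟨_, _, _, _, _, LinearMap.shortExact_shortComplexKer hp,
    inferInstanceAs (Module.Finite Λ (LinearMap.ker p)),
    inferInstanceAs (Module.Finite Λ (Fin k → Λ)), inferInstance⟩

theorem IsExtOrthogonal.exists_syzygy [IsNoetherianRing Λ] {X : ModuleCat.{u} Λ}
    (hX : IsExtOrthogonal X) : ∃ Y, IsExtOrthogonal Y ∧ IsHomExactExtension Y X := by
  have := hX.finite
  obtain ⟨K, P, i, p, w, hS, hK, hP, _⟩ := exists_shortExact_projective X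
  have := hX.subsingleton_ext
  have := (isExtOrthogonal_of_projective P).subsingleton_ext
  exact ⟨K, ⟨hK, fun k => subsingleton_ext_X₁ hS⟩, .of_shortExact hS⟩

theorem IsExtOrthogonal.exists_cosyzygy [IsNoetherian Λᵐᵒᵖ Λ] {X Q : ModuleCat.{u} Λ}
    (hX : IsExtOrthogonal X) [Projective Q] (i : X ⟶ Q) [Mono i] :
    ∃ Y, IsExtOrthogonal Y ∧ IsHomExactExtension X Y := by
  have := hX.finite
  have : IsNoetherian Λᵐᵒᵖ (X →ₗ[Λ] Λ) := isNoetherian_linearMap_of_smulCommClass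
  obtain ⟨m, f, hf⟩ := exists_left_approximation (Λ := Λ) Λᵐᵒᵖ (X := X) (Y := Λ)
  have := (IsProjective.iff_projective Q).2 ‹_›
  have hinj := injective_of_forall_exists_comp_eq ((ModuleCat.mono_iff_injective i).1 ‹_›) hf
  have hS := ModuleCat.shortComplex_shortExact (ModuleCat.shortComplexOfCompEqZero f
    (LinearMap.range f).mkQ (LinearMap.range_mkQ_comp f)) (LinearMap.exact_map_mkQ_range f) hinj
    (Submodule.mkQ_surjective _)
  have : Module.Finite Λ (ModuleCat.of Λ (Fin m → Λ)) :=
    inferInstanceAs (Module.Finite Λ (Fin m → Λ))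
  have := hX.subsingleton_ext
  have := (isExtOrthogonal_of_projective (ModuleCat.of Λ (Fin m → Λ))).subsingleton_ext
  have hone := (subsingleton_ext_one_iff hS).2 fun g => (hf g.hom).imp' ModuleCat.ofHom
    fun _ => ModuleCat.hom_ext
  refine ⟨_, ⟨inferInstanceAs (Module.Finite Λ (_ ⧸ LinearMap.range f)), fun k => ?_⟩,
    .of_shortExact hS⟩
  cases k with
  | zero => exact hone
  | succ k => exact subsingleton_ext_X₃ hS

namespace IsMinimalAuslanderGorenstein

variable {n : ℕ} [IsArtinianRing Λ] [IsNoetherian Λᵐᵒᵖ Λ]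

theorem isGorensteinProjective_of_isExtOrthogonal (hΛ : IsMinimalAuslanderGorenstein Λ n)
    {X : ModuleCat.{u} Λ} (hX : IsExtOrthogonal X) : IsGorensteinProjective Λ X := by
  refine isGorensteinProjective_of_closed IsExtOrthogonal (fun _ h => h.exists_syzygy)
    (fun Y hY => ?_) hX
  have := hY.finite
  have := hY.subsingleton_ext
  obtain ⟨Q, hQ, i, _⟩ := hΛ.exists_mono_prinj_of_subsingleton_ext Y
  have : Projective Q := prinj_le_isProjective _ hQ
  exact hY.exists_cosyzygy i

theorem hasGorensteinProjectiveResolution (hΛ : IsMinimalAuslanderGorenstein Λ n) {m : ℕ}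
    (X : ModuleCat.{u} Λ) [Module.Finite Λ X]
    (h : ∀ k, m ≤ k → Subsingleton (Ext X (ModuleCat.of Λ Λ) (k + 1))) :
    HasGorensteinProjectiveResolution Λ m X := by
  induction m generalizing X with
  | zero => exact hΛ.isGorensteinProjective_of_isExtOrthogonal ⟨‹_›, fun k => h k k.zero_le⟩
  | succ m ih =>
    obtain ⟨K, P, i, p, w, hS, hK, hP, _⟩ := exists_shortExact_projective X
    have hPo := isExtOrthogonal_of_projective P
    refine ⟨K, P, i.hom, p.hom, hS.moduleCat_injective_f,
      (ShortComplex.ShortExact.moduleCat_exact_iff_function_exact _).1 hS.exact,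
      hS.moduleCat_surjective_g, hΛ.isGorensteinProjective_of_isExtOrthogonal hPo,
      ih K fun k hk => ?_⟩
    have := hPo.subsingleton_ext k
    have := h (k + 1) (by omega)
    exact subsingleton_ext_X₁ hS

end IsMinimalAuslanderGorenstein

end Approximation

section Socle

variable {Λ : Type u} [Ring Λ] {n : ℕ} [IsArtinianRing Λ] {I : Type u} [AddCommGroup I]
  [Module Λ I] [Module.Finite Λ I]

namespace IsMinimalAuslanderGorenstein

theorem projective_of_gpd_socle_le (hΛ : IsMinimalAuslanderGorenstein Λ n) [Module.Injective Λ I]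
    (h : Gpd Λ (socle Λ I) ≤ n) : Module.Projective Λ I := by
  obtain ⟨m, hm, h⟩ := gpd_le_iff.1 h
  have := h.subsingleton_ext hm
  have : Module.Finite Λ (ModuleCat.of Λ (socle Λ I)) :=
    inferInstanceAs (Module.Finite Λ (socle Λ I))
  obtain ⟨Q, hQ, f, hf⟩ := hΛ.exists_mono_prinj_of_subsingleton_ext (.of Λ (socle Λ I))
  obtain ⟨Q, hQ, g, _⟩ := exists_mono_prinj (.of Λ I) fun S hS => by
    let j : S →ₗ[Λ] Q := f.hom ∘ₗ Submodule.inclusion (le_sSup hS)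
    have hj : Function.Injective j :=
      ((ModuleCat.mono_iff_injective f).1 hf).comp (Submodule.inclusion_injective _)
    have := IsSimpleModule.nontrivial Λ S
    obtain ⟨s, hs⟩ := exists_ne (0 : S)
    exact ⟨Q, hQ, ModuleCat.ofHom j, fun h₀ => hs (hj (congr($h₀ s).trans (map_zero j).symm))⟩
  have := Module.injective_object_of_injective_module Λ I
  exact (prinj_of_retract ⟨g, Injective.factorThru (𝟙 _) g, Injective.comp_factorThru _ _⟩ hQ).2.1

theorem gpd_socle_le [IsNoetherian Λᵐᵒᵖ Λ] (hΛ : IsMinimalAuslanderGorenstein Λ n)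
    [Module.Projective Λ I] : Gpd Λ (socle Λ I) ≤ n := by
  have : Module.Finite Λ (ModuleCat.of Λ (socle Λ I)) :=
    inferInstanceAs (Module.Finite Λ (socle Λ I))
  have : Mono (ModuleCat.ofHom (socle Λ I).subtype) :=
    (ModuleCat.mono_iff_injective _).2 (Submodule.injective_subtype _)
  exact gpd_le_iff.2 ⟨n, le_rfl, hΛ.hasGorensteinProjectiveResolution (.of Λ (socle Λ I))
    fun k hk => hΛ.subsingleton_ext_of_mono (ModuleCat.ofHom (socle Λ I).subtype) (.refl _)
      (Nat.succ_le_succ hk)⟩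

end IsMinimalAuslanderGorenstein

end Socle

theorem theorem3p2_general (Λ : Type u) [Ring Λ] [IsArtinianRing Λ] [IsNoetherian Λᵐᵒᵖ Λ]
    (n : ℕ) (hΛ : IsMinimalAuslanderGorenstein Λ n) :
    (∀ (I : Type u) [AddCommGroup I] [Module Λ I], Module.Finite Λ I → Module.Injective Λ I →
        (Module.Projective Λ I ↔ Gpd Λ (socle Λ I) ≤ n)) ∧
      prinj Λ = fun I : ModuleCat.{u} Λ =>
        Module.Finite Λ I ∧ Module.Injective Λ I ∧ Gpd Λ (socle Λ I) ≤ n := by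
  have main (I : Type u) [AddCommGroup I] [Module Λ I] (_ : Module.Finite Λ I)
      (_ : Module.Injective Λ I) : Module.Projective Λ I ↔ Gpd Λ (socle Λ I) ≤ n :=
    ⟨fun _ => hΛ.gpd_socle_le, hΛ.projective_of_gpd_socle_le⟩
  refine ⟨main, funext fun I => propext ?_⟩
  exact and_congr_right fun hfin => and_comm.trans (and_congr_right fun hinj => main I hfin hinj)

theorem theorem3p2 (R : Type v) [CommRing R] [IsArtinianRing R]
    (Λ : Type u) [Ring Λ] [Algebra R Λ] [Module.Finite R Λ]
    (n : ℕ) (hΛ : IsMinimalAuslanderGorenstein Λ n) :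
    (∀ (I : Type u) [AddCommGroup I] [Module Λ I], Module.Finite Λ I → Module.Injective Λ I →
        (Module.Projective Λ I ↔ Gpd Λ (socle Λ I) ≤ n)) ∧
      prinj Λ = fun I : ModuleCat.{u} Λ =>
        Module.Finite Λ I ∧ Module.Injective Λ I ∧ Gpd Λ (socle Λ I) ≤ n := by
  have : IsArtinianRing Λ := .of_finite R Λ
  have : IsNoetherian Λᵐᵒᵖ Λ := isNoetherian_of_tower R inferInstance
  exact theorem3p2_general Λ n hΛ
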